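/- Let $m,n\geq 1$ be integers, let $n^m$ be the rectangular Young diagram with $m$ rows and $n$ columns, and let $\lambda\subseteq n^m$ be a Young diagram with $p$ boxes. Then $$\frac{\dim(S^{\lambda}\mathbb{C}^m)\,\dim(S^{\lambda'}\mathbb{C}^n)}{\dim \Lambda^p(\mathbb{C}^m\otimes\mathbb{C}^n)}=\frac{f^{\lambda}\,f^{n^m/\lambda}}{f^{n^m}}.$$ Here $\lambda'$ is the conjugate (transposed) diagram; $S^{\mu}V$ is the Schur functor applied to $V$, i.e. the image of the Young symmetrizer $c_\mu$ acting on $V^{\otimes|\mu|}$ by permuting the tensor factors (for $V=\mathbb{C}^k$ this is the representation of $\mathrm{GL}_k$ corresponding to $\mu$); and, for a Young diagram or skew Young diagram $D$, $f^{D}$ is the dimension of the representation of the symmetric group $\mathfrak{S}_{|D|}$ corresponding to $D$, i.e. of the (skew) Specht module $\mathbb{C}[\mathfrak{S}_{|D|}]\,c_D$, where $c_D$ is the Young symmetrizer of $D$: the product of the sum of all permutations of the boxes of $D$ that preserve every row and the signed sum of all those that preserve every column. (For $D=\lambda$, $D=n^m$ and $D=n^m/\lambda$ this representation is irreducible.)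 -/

import Mathlib

open scoped TensorProduct

/-- The rectangular Young diagram `n^m` with `m` rows and `n` columns. -/
def rectDiagram (m n : ℕ) : YoungDiagram where
  cells := Finset.range m ×ˢ Finset.range n
  isLowerSet := by
    intro a b hab ha
    simp only [Finset.coe_product, Finset.coe_range, Set.mem_prod, Set.mem_Iio] at ha ⊢
    exact ⟨lt_of_le_of_lt hab.1 ha.1, lt_of_le_of_lt hab.2 ha.2⟩

/-- For a finite set `D` of boxes `(row, column)`, the sum in `ℂ[Sym D]` of all permutations of `D`
that preserve every row of `D`. -/
noncomputable def rowSymmetrizer (D : Finset (ℕ × ℕ)) : MonoidAlgebra ℂ (Equiv.Perm D) :=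
  ∑ σ : Equiv.Perm D with ∀ x : D, (σ x).1.1 = x.1.1, MonoidAlgebra.single σ 1

/-- The signed sum in `ℂ[Sym D]` of all permutations of `D` that preserve every column of `D`. -/
noncomputable def colAntisymmetrizer (D : Finset (ℕ × ℕ)) : MonoidAlgebra ℂ (Equiv.Perm D) :=
  ∑ σ : Equiv.Perm D with ∀ x : D, (σ x).1.2 = x.1.2,
    MonoidAlgebra.single σ ((Equiv.Perm.sign σ : ℤ) : ℂ)

/-- The Young symmetrizer `c_D = a_D b_D`. The symmetric group `Sym D` on the boxes of `D` is the
symmetric group on `p = |D|` letters, any labelling of the boxes by `1, …, p` identifying them. -/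
noncomputable def youngSymmetrizer (D : Finset (ℕ × ℕ)) : MonoidAlgebra ℂ (Equiv.Perm D) :=
  rowSymmetrizer D * colAntisymmetrizer D

/-- The (skew) Specht module of `D`: the left ideal `ℂ[Sym D] c_D`, a representation of `Sym D`.
For the set of boxes of a Young diagram `μ` it is the irreducible representation `V^μ`, and for
the set of boxes of a skew diagram it is the corresponding skew Specht module. -/
noncomputable def spechtModule (D : Finset (ℕ × ℕ)) : Ideal (MonoidAlgebra ℂ (Equiv.Perm D)) :=
  Ideal.span {youngSymmetrizer D}

/-- The dimension `f^D` of the representation of the symmetric group attached to the (skew)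
diagram `D`. -/
noncomputable def spechtDim (D : Finset (ℕ × ℕ)) : ℕ :=
  Module.finrank ℂ (spechtModule D)

/-- The action of `Sym D` on `V^{⊗ D}` by permuting the tensor factors. -/
noncomputable def tensorPermRep (D : Finset (ℕ × ℕ)) (V : Type*) [AddCommGroup V] [Module ℂ V] :
    Representation ℂ (Equiv.Perm D) (⨂[ℂ] _ : D, V) where
  toFun σ := (PiTensorProduct.reindex ℂ (fun _ : D => V) σ).toLinearMap
  map_one' := by
    ext v
    simp only [LinearMap.compMultilinearMap_apply, LinearEquiv.coe_coe,
      PiTensorProduct.reindex_tprod, Module.End.one_apply]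
    rfl
  map_mul' σ τ := by
    ext v
    simp only [LinearMap.compMultilinearMap_apply, LinearEquiv.coe_coe,
      PiTensorProduct.reindex_tprod, Module.End.mul_apply]
    rfl

/-- The Schur functor `S^μ` applied to `V`: the image of the Young symmetrizer of `μ` acting on
`V^{⊗ |μ|}`, the tensor factors being indexed by the boxes of `μ`. -/
noncomputable def schurModule (μ : YoungDiagram) (V : Type*) [AddCommGroup V] [Module ℂ V] :
    Submodule ℂ (⨂[ℂ] _ : μ.cells, V) :=
  LinearMap.range ((tensorPermRep μ.cells V).asAlgebraHom (youngSymmetrizer μ.cells))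

/-!
Write `c_D` for the Young symmetrizer of a diagram `D` and let `c_D ^ 2 = h_D c_D`; for a Young
diagram such an `h_D ≠ 0` exists by von Neumann's lemma (`rowSum_mul_single_mul_colSum`). As
`c_D / h_D` is idempotent, its ranks are traces. On the group algebra the trace gives
`h_D f^D = |D|!` (`IsHookConstant.mul_spechtRank`). On `(ℂ^m)^{⊗ D}` it gives
`h_D dim S^D(ℂ^m) = ∏ (m + c(x))`, the product over the boxes `x` of `D` with contents
`c(x) = column - row` (`fixTrace_youngElt`). The latter follows by removing corners one at a time:
the partial trace of `c_D` over the tensor factor of a corner `x` is `m + c(x)` times the Young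
symmetrizer of the remaining boxes (`partialTrace_youngElt`).

No hook length formula is needed, because hook constants enter the claim only through those of
`λ`, of its complement in the rectangle, and of the rectangle. These are related by the duality
`dim S^λ(ℂ^m) = dim S^μ(ℂ^m)`, where `μ` is the complement (`tensorRank_eq_of_complement`). To
prove it, the image of `c_D` is identified with the span of the functions
`X ↦ ∏_j (minor of X with the rows of the j-th column of D)` on `GL_m`, and Jacobi's complementary
minor theorem shows that `F ↦ (X ↦ det(X)^n F(X⁻ᵀ))` carries such products for `μ` to those
for `λ`.

Rotated by a half turn, `μ` is a Young diagram, and the content `c` of a box becomes `n - m - c`.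
Hence duality says `h_μ ∏_λ (m + c) = h_λ ∏_μ (n - c)` (`hookConstant_complement`), and the case
`λ = ∅` gives the hook constant `∏ (n - c)` of the rectangle (`hookConstant_rectDiagram`). With
`h_{λ'} = h_λ` (`IsHookConstant.transpose`), the identity of dimensions is then arithmetic.
-/

open Equiv MonoidAlgebra

/-! ### Young symmetrizers and von Neumann's lemma -/

lemma inv_preserves {α ι : Type*} {r : α → ι} {σ : Perm α} (h : ∀ x, r (σ x) = r x) (x : α) :
    r (σ⁻¹ x) = r x := by
  simpa using (h (σ⁻¹ x)).symm

lemma swap_preserves {α ι : Type*} [DecidableEq α] {r : α → ι} {x y : α} (h : r x = r y)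
    (z : α) : r (swap x y z) = r z := by
  by_cases hx : z = x
  · subst hx; simp [h]
  by_cases hy : z = y
  · subst hy; simp [h]
  rw [swap_apply_of_ne_of_ne hx hy]

section Diagram

variable {α : Type*}

/-- The boxes of `α`, labelled by row `r` and column `c`, form a Young diagram: boxes are
determined by their labels, and the set of labels is a lower set of `ℕ × ℕ`. -/
structure IsDiagram (r c : α → ℕ) : Prop where
  inj : ∀ x y, r x = r y → c x = c y → x = y
  lower : ∀ x i j, i ≤ r x → j ≤ c x → ∃ y, r y = i ∧ c y = j

variable [Fintype α]

/-- If some box of column `j` lies below the first `i` rows, the right side is `i`, and each row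
contributes at most `1` to the left side; otherwise the right side counts the whole column. -/
lemma card_rows_lt_inter_col_le {r c : α → ℕ} (hd : IsDiagram r c) (g : Perm α)
    (hg : ∀ x y, r x = r y → c (g x) = c (g y) → x = y) (i j : ℕ) :
    (Finset.univ.filter fun x => r x < i ∧ c (g x) = j).card ≤
      (Finset.univ.filter fun x => r x < i ∧ c x = j).card := by
  by_cases hcol : ∃ x, c x = j ∧ i ≤ r x
  · obtain ⟨x, hx, hix⟩ := hcol
    calc (Finset.univ.filter fun x => r x < i ∧ c (g x) = j).card ≤ (Finset.range i).card := by
          refine Finset.card_le_card_of_injOn r (fun y hy => ?_) (fun y hy z hz hyz => ?_)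
          · simp at hy ⊢; exact hy.1
          · simp at hy hz
            exact hg y z hyz (hy.2.trans hz.2.symm)
      _ ≤ _ := by
          refine Finset.card_le_card_of_surjOn r (fun k hk => ?_)
          simp only [Finset.coe_range, Set.mem_Iio] at hk
          obtain ⟨y, hy, hyj⟩ := hd.lower x k j (hk.le.trans hix) hx.ge
          exact ⟨y, by simp [hy, hyj, hk], hy⟩
  · push Not at hcol
    refine Finset.card_le_card_of_injOn g (fun y hy => ?_) g.injective.injOn
    simp at hy ⊢
    exact ⟨hcol _ hy.2, hy.2⟩

lemma card_rows_lt_inter_col_eq {r c : α → ℕ} (hd : IsDiagram r c) (g : Perm α)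
    (hg : ∀ x y, r x = r y → c (g x) = c (g y) → x = y) (i j : ℕ) :
    (Finset.univ.filter fun x => r x < i ∧ c (g x) = j).card =
      (Finset.univ.filter fun x => r x < i ∧ c x = j).card := by
  have hsum : ∀ k : Perm α, (Finset.univ.filter fun x => r x < i).card =
      ∑ j ∈ insert j (Finset.univ.image c),
        (Finset.univ.filter fun x => r x < i ∧ c (k x) = j).card := fun k => by
    rw [Finset.card_eq_sum_card_fiberwise (f := fun x => c (k x))
      (t := insert j (Finset.univ.image c)) (fun x _ => by simp)]
    simp only [Finset.filter_filter]
  exact (Finset.sum_eq_sum_iff_of_le fun j _ => card_rows_lt_inter_col_le hd g hg i j).mp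
    ((hsum g).symm.trans (hsum 1)) j (Finset.mem_insert_self _ _)

/-- If `g` sends distinct boxes of a row to distinct columns, the box in the row of `x` and the
column of `g x` exists: the first `i` rows meet each column in as many boxes as they have images
in it, for every `i`. -/
lemma exists_box_of_transversal {r c : α → ℕ} (hd : IsDiagram r c) (g : Perm α)
    (hg : ∀ x y, r x = r y → c (g x) = c (g y) → x = y) (x : α) :
    ∃ y, r y = r x ∧ c y = c (g x) := by
  by_contra! hno
  have h1 := card_rows_lt_inter_col_eq hd g hg (r x) (c (g x))
  have h2 := card_rows_lt_inter_col_eq hd g hg (r x + 1) (c (g x))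
  have h3 : (Finset.univ.filter fun y => r y < r x + 1 ∧ c y = c (g x)) =
      (Finset.univ.filter fun y => r y < r x ∧ c y = c (g x)) := by
    ext y
    simp only [Finset.mem_filter, Finset.mem_univ, true_and]
    refine ⟨fun h => ⟨lt_of_le_of_ne (Nat.lt_succ_iff.mp h.1) fun h' => hno y h' h.2, h.2⟩,
      fun h => ⟨h.1.trans (Nat.lt_succ_self _), h.2⟩⟩
  rw [h3, ← h1] at h2
  refine (Finset.card_lt_card ((Finset.ssubset_iff_of_subset (fun y hy => ?_)).mpr
    ⟨x, ?_, ?_⟩)).ne' h2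
  · simp at hy ⊢; exact ⟨hy.1.le, hy.2⟩
  · simp
  · simp

lemma exists_eq_col_mul_row {r c : α → ℕ} (hd : IsDiagram r c) (g : Perm α)
    (hg : ∀ x y, r x = r y → c (g x) = c (g y) → x = y) :
    ∃ v u : Perm α, (∀ x, c (v x) = c x) ∧ (∀ x, r (u x) = r x) ∧ g = v * u := by
  choose f hfr hfc using exists_box_of_transversal hd g hg
  have hf : Function.Injective f := fun x y hxy => hg x y
    (by rw [← hfr x, hxy, hfr y]) (by rw [← hfc x, hxy, hfc y])
  let u : Perm α := Equiv.ofBijective f (Finite.injective_iff_bijective.mp hf)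
  refine ⟨g * u⁻¹, u, fun x => ?_, hfr, by simp⟩
  have := hfc (u⁻¹ x)
  rw [Perm.mul_apply, ← this]
  exact congrArg c (show u (u⁻¹ x) = x by simp)

end Diagram

section Symmetrizers

variable {α ι κ : Type*} [Fintype α] [DecidableEq α] [DecidableEq ι] [DecidableEq κ]

/-- The sum of all permutations of `α` that preserve the row labelling `r`. -/
noncomputable def rowSum (r : α → ι) : MonoidAlgebra ℂ (Perm α) :=
  ∑ σ : Perm α with ∀ x, r (σ x) = r x, single σ 1

/-- The signed sum of all permutations of `α` that preserve the column labelling `c`. -/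
noncomputable def colSum (c : α → κ) : MonoidAlgebra ℂ (Perm α) :=
  ∑ σ : Perm α with ∀ x, c (σ x) = c x, single σ ((Perm.sign σ : ℤ) : ℂ)

/-- The Young symmetrizer of a finite set `α` of boxes with row labelling `r` and column
labelling `c`. -/
noncomputable def youngElt (r : α → ι) (c : α → κ) : MonoidAlgebra ℂ (Perm α) :=
  rowSum r * colSum c

lemma rowSum_mul_single {r : α → ι} {u : Perm α} (hu : ∀ x, r (u x) = r x) :
    rowSum r * single u 1 = rowSum r := by
  simp only [rowSum, Finset.sum_mul, single_mul_single, mul_one]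
  refine Finset.sum_equiv (Equiv.mulRight u) (fun σ => ?_) (fun _ _ => rfl)
  simp only [Finset.mem_filter, Finset.mem_univ, true_and, Equiv.coe_mulRight, Perm.mul_apply]
  refine ⟨fun h x => by rw [h, hu], fun h x => ?_⟩
  have := h (u⁻¹ x)
  rwa [inv_preserves hu, show u (u⁻¹ x) = x by simp] at this

lemma single_mul_colSum {c : α → κ} {v : Perm α} (hv : ∀ x, c (v x) = c x) :
    single v 1 * colSum c = ((Perm.sign v : ℤ) : ℂ) • colSum c := by
  simp only [colSum, Finset.mul_sum, single_mul_single, one_mul, Finset.smul_sum, smul_single]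
  refine Finset.sum_equiv (Equiv.mulLeft v) (fun σ => ?_) (fun σ _ => ?_)
  · simp only [Finset.mem_filter, Finset.mem_univ, true_and, Equiv.coe_mulLeft, Perm.mul_apply, hv]
  · have : ((Perm.sign v : ℤ) : ℂ) * ((Perm.sign v : ℤ) : ℂ) = 1 := by
      rw [← Int.cast_mul, ← Units.val_mul, Int.units_mul_self]; simp
    simp [← mul_assoc, this]

/-- If a column-preserving odd `v` is conjugate under `s` to a row-preserving `u`, then `s` is
annihilated between the row symmetrizer and the column antisymmetrizer. -/
lemma rowSum_mul_single_mul_colSum_eq_zero {r : α → ι} {c : α → κ} {u v s : Perm α}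
    (hu : ∀ x, r (u x) = r x) (hv : ∀ x, c (v x) = c x) (hsign : Perm.sign v = -1)
    (h : u * s = s * v) : rowSum r * single s 1 * colSum c = 0 := by
  have h1 : rowSum r * single s 1 * colSum c = -(rowSum r * single s 1 * colSum c) := by
    conv_lhs => rw [← rowSum_mul_single hu, mul_assoc (rowSum r), single_mul_single, h, mul_one,
      ← mul_one (1 : ℂ), ← single_mul_single, ← mul_assoc, mul_assoc _ (single v 1),
      single_mul_colSum hv, hsign]
    simp
  have h2 : (2 : ℂ) • (rowSum r * single s 1 * colSum c) = 0 := by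
    rw [two_smul]; nth_rewrite 2 [h1]; simp
  simpa using h2

/-- Von Neumann's lemma: either `g` is a product of a row-preserving and a column-preserving
permutation, or two boxes in one row have preimages in one column, and the term vanishes. -/
lemma rowSum_mul_single_mul_colSum {r c : α → ℕ} (hd : IsDiagram r c) (g : Perm α) :
    ∃ t : ℂ, rowSum r * single g 1 * colSum c = t • youngElt r c := by
  by_cases hg : ∀ x y, r x = r y → c (g⁻¹ x) = c (g⁻¹ y) → x = y
  · obtain ⟨v, u, hv, hu, h⟩ := exists_eq_col_mul_row hd g⁻¹ hg
    have hg' : g = u⁻¹ * v⁻¹ := by rw [← mul_inv_rev, ← h, inv_inv]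
    refine ⟨((Perm.sign v⁻¹ : ℤ) : ℂ), ?_⟩
    rw [hg', ← mul_one (1 : ℂ), ← single_mul_single, ← mul_assoc,
      rowSum_mul_single (inv_preserves hu), mul_assoc, single_mul_colSum (inv_preserves hv),
      mul_smul_comm, youngElt]
  · push Not at hg
    obtain ⟨x, y, hr, hc, hxy⟩ := hg
    refine ⟨0, ?_⟩
    rw [zero_smul]
    exact rowSum_mul_single_mul_colSum_eq_zero (swap_preserves hr) (swap_preserves hc)
      (Perm.sign_swap (g⁻¹.injective.ne hxy)) (swap_mul_eq_mul_swap g x y)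

lemma exists_youngElt_mul_self {r c : α → ℕ} (hd : IsDiagram r c) :
    ∃ h : ℂ, youngElt r c * youngElt r c = h • youngElt r c := by
  have key : ∀ x : MonoidAlgebra ℂ (Perm α),
      ∃ t : ℂ, rowSum r * x * colSum c = t • youngElt r c := fun x => by
    induction x using MonoidAlgebra.induction_linear with
    | zero => exact ⟨0, by simp⟩
    | add x y hx hy =>
      obtain ⟨s, hs⟩ := hx
      obtain ⟨t, ht⟩ := hy
      exact ⟨s + t, by rw [mul_add, add_mul, hs, ht, add_smul]⟩
    | single g z =>
      obtain ⟨t, ht⟩ := rowSum_mul_single_mul_colSum hd g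
      refine ⟨z * t, ?_⟩
      have hz : single g z = z • single g (1 : ℂ) := by simp
      rw [hz, mul_smul_comm, smul_mul_assoc, ht, smul_smul]
  obtain ⟨h, hh⟩ := key (colSum c * rowSum r)
  exact ⟨h, by rw [← hh]; simp only [youngElt, mul_assoc]⟩

end Symmetrizers

/-! ### Hook constants and dimensions of Specht modules -/

section Trace

/-- If `f ^ 2 = h f` then `h⁻¹ f` is a projection onto the range of `f`. -/
lemma mul_finrank_range_eq_trace {V : Type*} [AddCommGroup V] [Module ℂ V] [FiniteDimensional ℂ V]
    (f : V →ₗ[ℂ] V) {h : ℂ} (h0 : h ≠ 0) (hf : f * f = h • f) :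
    h * (Module.finrank ℂ (LinearMap.range f) : ℂ) = LinearMap.trace ℂ V f := by
  have hproj : LinearMap.IsProj (LinearMap.range f) (h⁻¹ • f) := by
    refine ⟨fun x => ⟨h⁻¹ • x, by simp⟩, ?_⟩
    rintro _ ⟨x, rfl⟩
    have : f (f x) = h • f x := by rw [← Module.End.mul_apply, hf, LinearMap.smul_apply]
    rw [LinearMap.smul_apply, this, smul_smul, inv_mul_cancel₀ h0, one_smul]
  rw [← hproj.trace, map_smul, smul_eq_mul, mul_inv_cancel_left₀ h0]

lemma trace_eq_card_fixed {V X : Type*} [AddCommGroup V] [Module ℂ V] [Fintype X] [DecidableEq X]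
    (b : Module.Basis X ℂ V) (f : V →ₗ[ℂ] V) (π : X → X) (hf : ∀ x, f (b x) = b (π x)) :
    LinearMap.trace ℂ V f = ((Finset.univ.filter fun x => π x = x).card : ℂ) := by
  rw [LinearMap.trace_eq_matrix_trace ℂ b, Matrix.trace]
  simp [LinearMap.toMatrix_apply, hf, Finsupp.single_apply]

end Trace

section HookConstant

variable {α ι κ : Type*} [Fintype α] [DecidableEq α] [DecidableEq ι] [DecidableEq κ]

lemma map_youngElt {M : Type*} [AddCommMonoid M] [Module ℂ M]
    (T : MonoidAlgebra ℂ (Perm α) →ₗ[ℂ] M) (r : α → ι) (c : α → κ) :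
    T (youngElt r c) = ∑ σ : Perm α with ∀ x, r (σ x) = r x, ∑ τ : Perm α with ∀ x, c (τ x) = c x,
      ((Perm.sign τ : ℤ) : ℂ) • T (single (σ * τ) 1) := by
  simp only [youngElt, rowSum, colSum, Finset.sum_mul, Finset.mul_sum, map_sum, single_mul_single,
    one_mul]
  rw [Finset.sum_comm]
  refine Finset.sum_congr rfl fun σ _ => Finset.sum_congr rfl fun τ _ => ?_
  rw [← map_smul, smul_single, smul_eq_mul, mul_one]

/-- The dimension of the left ideal generated by the Young symmetrizer. -/
noncomputable def spechtRank (r : α → ι) (c : α → κ) : ℕ :=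
  Module.finrank ℂ (LinearMap.range (LinearMap.mulRight ℂ (youngElt r c)))

lemma trace_mulRight_single (g : Perm α) :
    LinearMap.trace ℂ _ (LinearMap.mulRight ℂ (single g (1 : ℂ))) =
      if g = 1 then ((Fintype.card α).factorial : ℂ) else 0 := by
  rw [trace_eq_card_fixed (MonoidAlgebra.basis (Perm α) ℂ) _ (fun x => x * g)
    (fun x => by simp [basis_apply])]
  split_ifs with h
  · simp [h, Fintype.card_perm]
  · simp [h]

/-- Only the identity permutation preserves both rows and columns, so that the identity has
coefficient `1` in the Young symmetrizer. -/
lemma trace_mulRight_youngElt {r : α → ι} {c : α → κ}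
    (hinj : ∀ x y, r x = r y → c x = c y → x = y) :
    LinearMap.trace ℂ _ (LinearMap.mulRight ℂ (youngElt r c)) =
      ((Fintype.card α).factorial : ℂ) := by
  have h := map_youngElt
    (LinearMap.trace ℂ _ ∘ₗ (LinearMap.mul ℂ (MonoidAlgebra ℂ (Perm α))).flip) r c
  change LinearMap.trace ℂ _ (LinearMap.mulRight ℂ (youngElt r c)) = _ at h
  rw [h, Finset.sum_eq_single 1, Finset.sum_eq_single 1]
  · change _ • LinearMap.trace ℂ _ (LinearMap.mulRight ℂ (single _ 1)) = _
    rw [trace_mulRight_single]; simp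
  · intro τ _ hτ
    change _ • LinearMap.trace ℂ _ (LinearMap.mulRight ℂ (single _ 1)) = _
    rw [trace_mulRight_single, one_mul, if_neg hτ, smul_zero]
  · simp
  · intro σ hσ hσ1
    refine Finset.sum_eq_zero fun τ hτ => ?_
    change _ • LinearMap.trace ℂ _ (LinearMap.mulRight ℂ (single _ 1)) = _
    rw [trace_mulRight_single, if_neg, smul_zero]
    intro h1
    rw [mul_eq_one_iff_eq_inv] at h1
    simp only [Finset.mem_filter, Finset.mem_univ, true_and] at hσ hτ
    refine hσ1 (Equiv.ext fun x => hinj _ _ (hσ x) ?_)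
    rw [h1]
    exact inv_preserves hτ x
  · simp

/-- `h` is the constant in `c_D ^ 2 = h c_D` for the Young symmetrizer `c_D` of the boxes `α`
(for a Young diagram, the product of its hook lengths). -/
def IsHookConstant (r : α → ι) (c : α → κ) (h : ℂ) : Prop :=
  youngElt r c * youngElt r c = h • youngElt r c

/-- If `h = 0`, the Young symmetrizer acts nilpotently, while its trace is a factorial. -/
lemma IsHookConstant.ne_zero {r : α → ι} {c : α → κ}
    (hinj : ∀ x y, r x = r y → c x = c y → x = y) {h : ℂ} (hh : IsHookConstant r c h) : h ≠ 0 := by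
  rintro rfl
  have hnil : IsNilpotent (LinearMap.mulRight ℂ (youngElt r c)) := ⟨2, by
    ext1 x
    rw [IsHookConstant, zero_smul] at hh
    ext
    simp [pow_two, mul_assoc, hh]⟩
  have h1 := (LinearMap.isNilpotent_trace_of_isNilpotent hnil).eq_zero
  rw [trace_mulRight_youngElt hinj] at h1
  exact (Nat.cast_ne_zero.mpr (Nat.factorial_ne_zero _)) h1

lemma IsHookConstant.mul_spechtRank {r : α → ι} {c : α → κ}
    (hinj : ∀ x y, r x = r y → c x = c y → x = y) {h : ℂ} (hh : IsHookConstant r c h) :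
    h * (spechtRank r c : ℂ) = ((Fintype.card α).factorial : ℂ) := by
  rw [spechtRank, mul_finrank_range_eq_trace _ (hh.ne_zero hinj), trace_mulRight_youngElt hinj]
  rw [IsHookConstant] at hh
  refine LinearMap.ext fun x => ?_
  simp [mul_assoc, hh]

/-- The algebra homomorphism `σ ↦ sgn(σ) σ⁻¹` from the group algebra to its opposite. -/
noncomputable def signInv : MonoidAlgebra ℂ (Perm α) →ₐ[ℂ] (MonoidAlgebra ℂ (Perm α))ᵐᵒᵖ :=
  MonoidAlgebra.lift ℂ _ (Perm α)
    { toFun := fun σ => MulOpposite.op (single σ⁻¹ ((Perm.sign σ : ℤ) : ℂ))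
      map_one' := by simp [MonoidAlgebra.one_def]
      map_mul' := fun σ τ => by
        rw [← MulOpposite.op_mul, single_mul_single, mul_inv_rev, Perm.sign_mul]
        simp [mul_comm] }

lemma signInv_single (σ : Perm α) (z : ℂ) :
    signInv (single σ z) = MulOpposite.op (single σ⁻¹ (z * ((Perm.sign σ : ℤ) : ℂ))) := by
  simp [signInv, ← MulOpposite.op_smul, smul_single]

lemma signInv_rowSum (r : α → ι) : signInv (rowSum r) = MulOpposite.op (colSum r) := by
  rw [rowSum, colSum, map_sum, Finset.op_sum]
  refine Finset.sum_equiv (Equiv.inv _) (fun σ => ?_) (fun σ _ => ?_)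
  · simp only [Finset.mem_filter, Finset.mem_univ, true_and, Equiv.inv_apply]
    exact ⟨fun h => inv_preserves h, fun h => by simpa using inv_preserves h⟩
  · simp [signInv_single]

lemma signInv_colSum (c : α → κ) : signInv (colSum c) = MulOpposite.op (rowSum c) := by
  rw [rowSum, colSum, map_sum, Finset.op_sum]
  refine Finset.sum_equiv (Equiv.inv _) (fun σ => ?_) (fun σ _ => ?_)
  · simp only [Finset.mem_filter, Finset.mem_univ, true_and, Equiv.inv_apply]
    exact ⟨fun h => inv_preserves h, fun h => by simpa using inv_preserves h⟩
  · have : ((Perm.sign σ : ℤ) : ℂ) * ((Perm.sign σ : ℤ) : ℂ) = 1 := by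
      rw [← Int.cast_mul, ← Units.val_mul, Int.units_mul_self]; simp
    rw [signInv_single, this, Equiv.inv_apply]

lemma IsHookConstant.transpose {r : α → ι} {c : α → κ} {h : ℂ} (hh : IsHookConstant r c h) :
    IsHookConstant c r h := by
  have key : signInv (youngElt r c) = MulOpposite.op (youngElt c r) := by
    rw [youngElt, map_mul, signInv_rowSum, signInv_colSum, ← MulOpposite.op_mul, youngElt]
  have h1 := congrArg signInv hh
  rw [map_mul, map_smul, key, ← MulOpposite.op_mul, ← MulOpposite.op_smul] at h1
  exact MulOpposite.op_injective h1

variable {β : Type*} [Fintype β] [DecidableEq β]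

/-- Relabelling the boxes along a bijection. -/
noncomputable def relabel {α β : Type*} (e : β ≃ α) :
    MonoidAlgebra ℂ (Perm α) →ₐ[ℂ] MonoidAlgebra ℂ (Perm β) :=
  MonoidAlgebra.mapDomainAlgHom ℂ ℂ (e.symm.permCongrHom : Perm α →* Perm β)

lemma relabel_single {α β : Type*} (e : β ≃ α) (σ : Perm α) (z : ℂ) :
    relabel e (single σ z) = single (e.symm.permCongr σ) z := by
  simp [relabel, permCongrHom]

lemma relabel_youngElt (e : β ≃ α) (r : α → ι) (c : α → κ) :
    relabel e (youngElt r c) = youngElt (r ∘ e) (c ∘ e) := by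
  have hr : relabel e (rowSum r) = rowSum (r ∘ e) := by
    rw [rowSum, rowSum, map_sum]
    refine Finset.sum_equiv e.symm.permCongr (fun σ => ?_) (fun σ _ => ?_)
    · simp [permCongr_apply, ← e.forall_congr_right]
    · rw [relabel_single]
  have hc : relabel e (colSum c) = colSum (c ∘ e) := by
    rw [colSum, colSum, map_sum]
    refine Finset.sum_equiv e.symm.permCongr (fun σ => ?_) (fun σ _ => ?_)
    · simp [permCongr_apply, ← e.forall_congr_right]
    · rw [relabel_single, Perm.sign_permCongr]
  rw [youngElt, map_mul, hr, hc, youngElt]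

lemma IsHookConstant.comp_equiv {r : α → ι} {c : α → κ} {h : ℂ} (hh : IsHookConstant r c h)
    (e : β ≃ α) : IsHookConstant (r ∘ e) (c ∘ e) h := by
  have h1 := congrArg (relabel e) hh
  rwa [map_mul, map_smul, relabel_youngElt] at h1

end HookConstant

/-! ### Fixed points and the partial trace over a corner -/

section FixedPoints

variable {α β : Type*} [Fintype α] [DecidableEq α] [Fintype β] [DecidableEq β]

/-- The number of maps `α → Fin m` fixed by `σ`, i.e. `m` to the number of cycles of `σ`: the trace
of `σ` on the `α`-th tensor power of `ℂ^m`. -/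
def fixCount (m : ℕ) (σ : Perm α) : ℕ :=
  (Finset.univ.filter fun f : α → Fin m => f ∘ σ = f).card

lemma comp_perm_option_eq_iff {γ : Type*} (σ : Perm (Option β)) (f : Option β → γ) :
    f ∘ σ = f ↔ f none = f (σ none) ∧ (f ∘ some) ∘ removeNone σ = f ∘ some := by
  have key : f none = f (σ none) → ∀ x, f (some (removeNone σ x)) = f (σ (some x)) := by
    intro h x
    by_cases hx : ∃ x', σ (some x) = some x'
    · rw [removeNone_some _ hx]
    · have hx' : σ (some x) = none := by
        rw [← Option.not_isSome_iff_eq_none, Option.isSome_iff_exists]; exact hx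
      rw [removeNone_none _ hx', hx', ← h]
  constructor
  · intro h
    have h0 : f none = f (σ none) := (congrFun h none).symm
    exact ⟨h0, funext fun x => (key h0 x).trans (congrFun h (some x))⟩
  · rintro ⟨h0, h⟩
    funext x
    cases x with
    | none => exact h0.symm
    | some x => exact (key h0 x).symm.trans (congrFun h x)

/-- A fixed map is determined off `none`, and is free at `none` only if `none` is its own cycle. -/
lemma fixCount_option (m : ℕ) (σ : Perm (Option β)) :
    fixCount m σ = (if σ none = none then m else 1) * fixCount m (removeNone σ) := by
  unfold fixCount
  simp only [comp_perm_option_eq_iff]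
  split_ifs with h
  · have hm : ∀ k, m * k = (Finset.univ : Finset (Fin m)).card * k := fun k => by simp
    rw [hm, ← Finset.card_product]
    refine Finset.card_equiv Equiv.piOptionEquivProd fun f => ?_
    simp [h, Function.comp_def]
  · obtain ⟨y, hy⟩ := Option.ne_none_iff_exists'.mp h
    rw [one_mul]
    refine Finset.card_nbij' (fun f => f ∘ some) (fun g o => o.elim (g y) g) ?_ ?_ ?_ ?_
    · intro f hf; simp at hf ⊢; exact hf.2
    · intro g hg; simp [hy] at hg ⊢; exact hg
    · intro f hf
      simp [hy] at hf
      funext o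
      cases o <;> simp [hf.1]
    · intro g _; rfl

/-- The trace of the action of `ℂ[Sym α]` on the `α`-th tensor power of `ℂ^m`. -/
noncomputable def fixTrace (m : ℕ) : MonoidAlgebra ℂ (Perm α) →ₗ[ℂ] ℂ :=
  (MonoidAlgebra.basis (Perm α) ℂ).constr ℂ fun σ => (fixCount m σ : ℂ)

lemma fixTrace_single (m : ℕ) (σ : Perm α) (z : ℂ) :
    fixTrace m (single σ z) = z * fixCount m σ := by
  have h : single σ z = z • MonoidAlgebra.basis (Perm α) ℂ σ := by simp [basis_apply]
  rw [h, map_smul, fixTrace, Module.Basis.constr_basis, smul_eq_mul]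

lemma fixTrace_relabel (m : ℕ) (e : β ≃ α) (x : MonoidAlgebra ℂ (Perm α)) :
    fixTrace m (relabel e x) = fixTrace m x := by
  induction x using MonoidAlgebra.induction_linear with
  | zero => simp
  | add x y hx hy => simp [hx, hy]
  | single σ z =>
    rw [relabel_single, fixTrace_single, fixTrace_single]
    congr 2
    refine Finset.card_equiv (e.arrowCongr (Equiv.refl _)) fun f => ?_
    simp only [Finset.mem_filter, Finset.mem_univ, true_and]
    rw [funext_iff, funext_iff, ← e.forall_congr_right]
    simp [permCongr_apply]

end FixedPoints

section PartialTrace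

variable {β : Type*}

/-- The partial trace over the tensor factor `none`. -/
noncomputable def partialTrace (m : ℕ) :
    MonoidAlgebra ℂ (Perm (Option β)) →ₗ[ℂ] MonoidAlgebra ℂ (Perm β) :=
  (MonoidAlgebra.basis (Perm (Option β)) ℂ).constr ℂ fun σ =>
    single (removeNone σ) (if σ none = none then (m : ℂ) else 1)

lemma partialTrace_single (m : ℕ) (σ : Perm (Option β)) (z : ℂ) :
    partialTrace m (single σ z) =
      single (removeNone σ) (z * if σ none = none then (m : ℂ) else 1) := by
  have h : single σ z = z • MonoidAlgebra.basis (Perm (Option β)) ℂ σ := by simp [basis_apply]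
  rw [h, map_smul, partialTrace, Module.Basis.constr_basis, smul_single, smul_eq_mul]

lemma optionCongr_mul {β : Type*} (a b : Perm β) :
    optionCongr (a * b) = optionCongr a * optionCongr b :=
  Equiv.ext fun x => by cases x <;> simp

/-- The inclusion of `ℂ[Sym β]` into `ℂ[Sym (Option β)]`. -/
noncomputable def extendNone :
    MonoidAlgebra ℂ (Perm β) →ₐ[ℂ] MonoidAlgebra ℂ (Perm (Option β)) :=
  MonoidAlgebra.mapDomainAlgHom ℂ ℂ
    { toFun := optionCongr
      map_one' := optionCongr_one
      map_mul' := optionCongr_mul }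

lemma extendNone_single (σ : Perm β) (z : ℂ) :
    extendNone (single σ z) = single (optionCongr σ) z := by
  simp [extendNone]

variable [DecidableEq β]

/-- `removeNone` deletes `none` from its cycle, which commutes with permutations fixing `none`. -/
lemma removeNone_mul_mul (u v : Perm β) (s : Perm (Option β)) :
    removeNone (optionCongr u * s * optionCongr v) = u * removeNone s * v := by
  apply optionCongr_injective
  rw [optionCongr_mul, optionCongr_mul, map_equiv_removeNone, map_equiv_removeNone, ← mul_assoc, ← mul_assoc]
  congr 1
  rw [← mul_assoc, mul_swap_eq_swap_mul]
  simp

lemma partialTrace_mul_mul (m : ℕ) (x y : MonoidAlgebra ℂ (Perm β))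
    (s : MonoidAlgebra ℂ (Perm (Option β))) :
    partialTrace m (extendNone x * s * extendNone y) = x * partialTrace m s * y := by
  induction x using MonoidAlgebra.induction_linear with
  | zero => simp
  | add x x' hx hx' => simp only [map_add, add_mul, hx, hx']
  | single u z =>
    induction y using MonoidAlgebra.induction_linear with
    | zero => simp
    | add y y' hy hy' => simp only [map_add, mul_add, hy, hy']
    | single v w =>
      induction s using MonoidAlgebra.induction_linear with
      | zero => simp
      | add s s' hs hs' => simp only [map_add, mul_add, add_mul, hs, hs']
      | single s t =>
        simp only [extendNone_single, single_mul_single, partialTrace_single, removeNone_mul_mul]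
        congr 1
        simp
        ring_nf

lemma removeNone_swap_mul_swap {x y : β} (h : x ≠ y) :
    removeNone (swap none (some y) * swap none (some x)) = swap x y := by
  apply optionCongr_injective
  rw [map_equiv_removeNone, optionCongr_swap, Perm.mul_apply, swap_apply_left,
    swap_apply_of_ne_of_ne (by simp) (by simpa using h), ← mul_assoc]
  rw [swap_comm none (some y), swap_comm none (some x), swap_comm (some x) (some y)]
  rw [swap_comm (some x) none, swap_mul_swap_mul_swap]
  · rw [swap_comm]
  · simp
  · simpa using h.symm

variable [Fintype β]

lemma fixTrace_partialTrace (m : ℕ) (x : MonoidAlgebra ℂ (Perm (Option β))) :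
    fixTrace m (partialTrace m x) = fixTrace m x := by
  induction x using MonoidAlgebra.induction_linear with
  | zero => simp
  | add x y hx hy => simp [hx, hy]
  | single σ z =>
    rw [partialTrace_single, fixTrace_single, fixTrace_single, fixCount_option]
    split_ifs <;> push_cast <;> ring

variable {ι κ : Type*} [DecidableEq ι] [DecidableEq κ]

lemma sum_preserving_perm_option {M : Type*} [AddCommMonoid M] (r : Option β → ι)
    (F : Perm (Option β) → M) :
    ∑ σ : Perm (Option β) with ∀ x, r (σ x) = r x, F σ =
      ∑ y with r y = r none, ∑ u : Perm β with ∀ x, r (some (u x)) = r (some x),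
        F (swap none y * optionCongr u) := by
  rw [← Finset.sum_product']
  refine Finset.sum_equiv Equiv.Perm.decomposeOption (fun σ => ?_) (fun σ _ => by simp)
  obtain ⟨⟨y, u⟩, rfl⟩ := Equiv.Perm.decomposeOption.symm.surjective σ
  rw [Equiv.apply_symm_apply]
  simp only [Finset.mem_filter, Finset.mem_univ, true_and, Finset.mem_product,
    Equiv.Perm.decomposeOption_symm_apply]
  constructor
  · intro h
    have hy : r y = r none := by simpa using h none
    refine ⟨hy, fun x => ?_⟩
    have := h (some x)
    rwa [Perm.mul_apply, swap_preserves hy.symm] at this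
  · rintro ⟨hy, hu⟩ x
    rw [Perm.mul_apply, swap_preserves hy.symm]
    cases x <;> simp [hu]

lemma colSum_option (c : Option β → κ) :
    colSum c = ∑ y with c y = c none,
      single (swap none y) (if y = none then (1 : ℂ) else -1) *
        extendNone (colSum (c ∘ some)) := by
  rw [colSum, sum_preserving_perm_option]
  refine Finset.sum_congr rfl fun y _ => ?_
  simp only [colSum, Function.comp_apply, map_sum, Finset.mul_sum]
  refine Finset.sum_congr rfl fun u _ => ?_
  rw [extendNone_single, single_mul_single]
  by_cases hy : y = none
  · simp [hy]
  · simp [hy, Perm.sign_swap (Ne.symm hy)]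

/-- The transposition stands on the right here and on the left in `colSum_option`, so that they meet
in the product of the two. -/
lemma rowSum_option (r : Option β → ι) :
    rowSum r = ∑ y with r y = r none,
      extendNone (rowSum (r ∘ some)) * single (swap none y) 1 := by
  have hinv : rowSum r = ∑ σ : Perm (Option β) with ∀ x, r (σ x) = r x, single σ⁻¹ 1 := by
    refine Finset.sum_equiv (Equiv.inv _) (fun σ => ?_) (fun σ _ => by simp)
    simp only [Finset.mem_filter, Finset.mem_univ, true_and, Equiv.inv_apply]
    exact ⟨fun h => inv_preserves h, fun h => by simpa using inv_preserves h⟩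
  rw [hinv, sum_preserving_perm_option]
  refine Finset.sum_congr rfl fun y _ => ?_
  simp only [rowSum, Function.comp_apply, map_sum, Finset.sum_mul]
  refine Finset.sum_equiv (Equiv.inv _) (fun σ => ?_) (fun σ _ => ?_)
  · simp only [Finset.mem_filter, Finset.mem_univ, true_and, Equiv.inv_apply]
    exact ⟨fun h => inv_preserves (r := fun x => r (some x)) h,
      fun h => by simpa using inv_preserves (r := fun x => r (some x)) h⟩
  · rw [extendNone_single, single_mul_single, mul_inv_rev, swap_inv, one_mul]
    rfl

/-- Removing the corner `none` from a diagram multiplies the partial trace of the Young symmetrizer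
by `m` plus the content of the corner: the mixed terms vanish, because the box in the column of `y`
and the row of `x` provides the transpositions required for
`rowSum_mul_single_mul_colSum_eq_zero`. -/
lemma partialTrace_youngElt (m : ℕ) {r : Option β → ι} {c : Option β → κ}
    (hinj : ∀ x y, r x = r y → c x = c y → x = y)
    (hcorner : ∀ x y, c (some x) = c none → r (some y) = r none →
      ∃ d, r (some d) = r (some x) ∧ c (some d) = c (some y)) :
    partialTrace m (youngElt r c) =
      ((m : ℂ) + (Finset.univ.filter fun y => r (some y) = r none).card -
        (Finset.univ.filter fun x => c (some x) = c none).card) •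
        youngElt (r ∘ some) (c ∘ some) := by
  have hterm : ∀ y x (z : ℂ), partialTrace m (extendNone (rowSum (r ∘ some)) *
      single (swap none y) 1 * (single (swap none x) z * extendNone (colSum (c ∘ some)))) =
      z • (rowSum (r ∘ some) * single (removeNone (swap none y * swap none x))
        (if (swap none y * swap none x) none = none then (m : ℂ) else 1) *
          colSum (c ∘ some)) := by
    intro y x z
    rw [← mul_assoc, mul_assoc (extendNone _), single_mul_single, partialTrace_mul_mul,
      partialTrace_single, one_mul]
    rw [← smul_mul_assoc, ← mul_smul_comm, smul_single, smul_eq_mul]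
  rw [youngElt, rowSum_option, colSum_option, Finset.sum_mul_sum]
  simp only [map_sum, hterm]
  have hrow : (Finset.univ.filter fun y => r y = r none) =
      insert none ((Finset.univ.filter fun y => r (some y) = r none).map
        Function.Embedding.some) := by
    ext o; cases o <;> simp
  have hcol : (Finset.univ.filter fun y => c y = c none) =
      insert none ((Finset.univ.filter fun y => c (some y) = c none).map
        Function.Embedding.some) := by
    ext o; cases o <;> simp
  have hone : ∀ t : ℂ, rowSum (r ∘ some) * single 1 t * colSum (c ∘ some) =
      t • youngElt (r ∘ some) (c ∘ some) := fun t => by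
    have : single (1 : Perm β) t = t • 1 := by rw [MonoidAlgebra.one_def, smul_single]; simp
    rw [this, mul_smul_comm, smul_mul_assoc, mul_one, youngElt]
  have hrm : ∀ x : β, removeNone (swap none (some x)) = 1 := fun x => by
    apply optionCongr_injective
    rw [map_equiv_removeNone]; simp
  have hrm1 : removeNone (1 : Perm (Option β)) = 1 := by
    apply optionCongr_injective
    rw [map_equiv_removeNone]; simp [Perm.one_def]
  have hmixed : ∀ y x, r (some y) = r none → c (some x) = c none →
      rowSum (r ∘ some) * single (removeNone (swap none (some y) * swap none (some x)))
        (if (swap none (some y) * swap none (some x)) none = none then (m : ℂ) else 1) *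
          colSum (c ∘ some) = 0 := by
    intro y x hy hx
    have hxy : x ≠ y := by
      rintro rfl
      exact absurd (hinj _ _ hy hx) (by simp)
    rw [removeNone_swap_mul_swap hxy, if_neg (by
      rw [Perm.mul_apply, swap_apply_left, swap_apply_of_ne_of_ne (by simp) (by simpa using hxy)]
      simp)]
    obtain ⟨d, hdr, hdc⟩ := hcorner x y hx hy
    have hdy : d ≠ y := by
      rintro rfl
      exact absurd (hinj _ _ (hdr.symm.trans hy) hx) (by simp)
    have hdx : d ≠ x := by
      rintro rfl
      exact absurd (hinj _ _ hy (hdc.symm.trans hx)) (by simp)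
    refine rowSum_mul_single_mul_colSum_eq_zero (u := swap x d) (v := swap y d)
      (swap_preserves hdr.symm) (swap_preserves hdc.symm) (Perm.sign_swap hdy.symm) ?_
    rw [mul_swap_eq_swap_mul (swap x y), swap_apply_right, swap_apply_of_ne_of_ne hdx hdy]
  let F : Option β → Option β → MonoidAlgebra ℂ (Perm β) := fun y x =>
    (if x = none then (1 : ℂ) else -1) •
      (rowSum (r ∘ some) * single (removeNone (swap none y * swap none x))
        (if (swap none y * swap none x) none = none then (m : ℂ) else 1) * colSum (c ∘ some))
  have h00 : F none none = (m : ℂ) • youngElt (r ∘ some) (c ∘ some) := by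
    simp [F, ← Perm.one_def, hrm1, hone]
  have h10 : ∀ y, F (some y) none = youngElt (r ∘ some) (c ∘ some) := fun y => by
    simp [F, ← Perm.one_def, hrm, hone]
  have h01 : ∀ x, F none (some x) = -youngElt (r ∘ some) (c ∘ some) := fun x => by
    simp [F, ← Perm.one_def, hrm, hone]
  have h11 : ∀ y x, r (some y) = r none → c (some x) = c none → F (some y) (some x) = 0 :=
    fun y x hy hx => by
      simp only [F]
      rw [hmixed y x hy hx, smul_zero]
  change ∑ y with r y = r none, ∑ x with c x = c none, F y x = _
  have hsome : ∀ y ∈ (Finset.univ.filter fun y => r (some y) = r none),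
      ∑ x with c x = c none, F (some y) x = youngElt (r ∘ some) (c ∘ some) := fun y hy => by
    rw [hcol, Finset.sum_insert (by simp), Finset.sum_map, h10, Finset.sum_eq_zero, add_zero]
    intro x hx
    exact h11 y x (by simpa using hy) (by simpa using hx)
  rw [hrow, Finset.sum_insert (by simp), Finset.sum_map]
  simp only [Function.Embedding.some_apply]
  rw [Finset.sum_congr rfl hsome, hcol, Finset.sum_insert (by simp), Finset.sum_map]
  simp only [Function.Embedding.some_apply, h00, h01, Finset.sum_const]
  module

end PartialTrace

/-! ### The content product formula -/

section ContentFormula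

/-- A box that maximizes row plus column is the last one of its row and of its column. -/
lemma exists_corner {α : Type*} [Fintype α] [Nonempty α] (r c : α → ℕ) :
    ∃ p, (∀ y, r y = r p → c y ≤ c p) ∧ (∀ y, c y = c p → r y ≤ r p) := by
  obtain ⟨p, -, hp⟩ := Finset.exists_max_image Finset.univ (fun x : α => r x + c x)
    Finset.univ_nonempty
  refine ⟨p, fun y hy => ?_, fun y hy => ?_⟩ <;>
  · have := hp y (Finset.mem_univ y)
    omega

/-- The trace of the Young symmetrizer on the tensor power of `ℂ^m` is the product of `m` plus the
contents of the boxes. -/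
theorem fixTrace_youngElt (m : ℕ) {α : Type*} [Fintype α] [DecidableEq α] {r c : α → ℕ}
    (hd : IsDiagram r c) : fixTrace m (youngElt r c) = ∏ x, ((m : ℂ) + c x - r x) := by
  induction hn : Fintype.card α generalizing α with
  | zero =>
    have := Fintype.card_eq_zero_iff.mp hn
    rw [map_youngElt]
    simp [Finset.univ_unique, fixTrace_single, fixCount, Finset.filter_true_of_mem,
      Subsingleton.elim _ (1 : Perm α)]
  | succ n ih =>
    have : Nonempty α := Fintype.card_pos_iff.mp (by omega)
    obtain ⟨p, hpr, hpc⟩ := exists_corner r c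
    let e : Option {x // x ≠ p} ≃ α := optionSubtypeNe p
    have hcard : Fintype.card {x // x ≠ p} = n := by
      have := Fintype.card_congr e
      rw [Fintype.card_option] at this
      omega
    have hd' : IsDiagram ((r ∘ e) ∘ some) ((c ∘ e) ∘ some) := by
      refine ⟨fun x y h1 h2 => Subtype.ext (hd.inj _ _ h1 h2), fun x i j hi hj => ?_⟩
      obtain ⟨y, hy1, hy2⟩ := hd.lower x i j hi hj
      refine ⟨⟨y, ?_⟩, hy1, hy2⟩
      rintro rfl
      have hri : r y ≤ r x := hy1 ▸ hi
      have hcj : c y ≤ c x := hy2 ▸ hj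
      obtain ⟨z, hz1, hz2⟩ := hd.lower x (r x) (c y) le_rfl hcj
      have h1 := hpc z hz2
      obtain ⟨w, hw1, hw2⟩ := hd.lower x (r y) (c x) hri le_rfl
      have h2 := hpr w hw1
      exact x.2 (hd.inj _ _ (by omega) (by omega))
    have hrow : (Finset.univ.filter fun y => (r ∘ e) (some y) = (r ∘ e) none).card = c p := by
      rw [← Finset.card_range (c p)]
      refine Finset.card_bij (fun y _ => c y) (fun y hy => ?_) (fun y hy z hz h => ?_)
        (fun j hj => ?_)
      · simp [e] at hy ⊢
        exact lt_of_le_of_ne (hpr y hy) fun h => y.2 (hd.inj _ _ hy h)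
      · simp [e] at hy hz
        exact Subtype.ext (hd.inj _ _ (hy.trans hz.symm) h)
      · rw [Finset.mem_range] at hj
        obtain ⟨y, hy1, hy2⟩ := hd.lower p (r p) j le_rfl hj.le
        exact ⟨⟨y, by rintro rfl; omega⟩, by simpa [e] using hy1, hy2⟩
    have hcol : (Finset.univ.filter fun y => (c ∘ e) (some y) = (c ∘ e) none).card = r p := by
      rw [← Finset.card_range (r p)]
      refine Finset.card_bij (fun y _ => r y) (fun y hy => ?_) (fun y hy z hz h => ?_)
        (fun j hj => ?_)
      · simp [e] at hy ⊢
        exact lt_of_le_of_ne (hpc y hy) fun h => y.2 (hd.inj _ _ h hy)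
      · simp [e] at hy hz
        exact Subtype.ext (hd.inj _ _ h (hy.trans hz.symm))
      · rw [Finset.mem_range] at hj
        obtain ⟨y, hy1, hy2⟩ := hd.lower p j (c p) hj.le le_rfl
        exact ⟨⟨y, by rintro rfl; omega⟩, by simpa [e] using hy2, hy1⟩
    have hcorner : ∀ x y : {x // x ≠ p}, (c ∘ e) (some x) = (c ∘ e) none →
        (r ∘ e) (some y) = (r ∘ e) none → ∃ d, (r ∘ e) (some d) = (r ∘ e) (some x) ∧
          (c ∘ e) (some d) = (c ∘ e) (some y) := by
      intro x y hx hy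
      change c x = c p at hx
      change r y = r p at hy
      obtain ⟨d, hd1, hd2⟩ := hd.lower p (r x) (c y) (hpc x hx) (hpr y hy)
      refine ⟨⟨d, ?_⟩, hd1, hd2⟩
      rintro rfl
      exact x.2 (hd.inj _ _ hd1.symm hx)
    rw [← fixTrace_relabel m e, relabel_youngElt, ← fixTrace_partialTrace,
      partialTrace_youngElt m (r := r ∘ e) (c := c ∘ e) (fun x y h1 h2 => e.injective (hd.inj _ _ h1 h2)) hcorner,
      map_smul, ih hd' hcard, hrow, hcol, ← e.prod_comp, Fintype.prod_option, smul_eq_mul]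
    rfl

end ContentFormula

/-! ### Tensor powers and complementary minors -/

section TensorPower

variable {α : Type*}

/-- The action of `Sym α` on `V^{⊗ α}` by permuting the tensor factors, as `tensorPermRep` but over
an arbitrary index type. -/
noncomputable def tensorRep (α V : Type*) [AddCommGroup V] [Module ℂ V] :
    Representation ℂ (Perm α) (⨂[ℂ] _ : α, V) where
  toFun σ := (PiTensorProduct.reindex ℂ (fun _ : α => V) σ).toLinearMap
  map_one' := by
    ext v
    simp only [LinearMap.compMultilinearMap_apply, LinearEquiv.coe_coe,
      PiTensorProduct.reindex_tprod, Module.End.one_apply]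
    rfl
  map_mul' σ τ := by
    ext v
    simp only [LinearMap.compMultilinearMap_apply, LinearEquiv.coe_coe,
      PiTensorProduct.reindex_tprod, Module.End.mul_apply]
    rfl

/-- The basis of `(ℂ^m)^{⊗ α}` indexed by maps `α → Fin m`. -/
noncomputable def tensorBasis (α : Type*) [Finite α] (m : ℕ) :
    Module.Basis (α → Fin m) ℂ (⨂[ℂ] _ : α, Fin m → ℂ) :=
  Basis.piTensorProduct fun _ => Pi.basisFun ℂ (Fin m)

lemma tensorRep_tensorBasis [Finite α] {m : ℕ} (σ : Perm α) (f : α → Fin m) :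
    tensorRep α (Fin m → ℂ) σ (tensorBasis α m f) = tensorBasis α m (f ∘ σ.symm) := by
  rw [tensorBasis, Basis.piTensorProduct_apply, Basis.piTensorProduct_apply]
  exact PiTensorProduct.reindex_tprod _ _

lemma repr_tensorRep [Finite α] {m : ℕ} (σ : Perm α) (t : ⨂[ℂ] _ : α, Fin m → ℂ)
    (f : α → Fin m) :
    (tensorBasis α m).repr (tensorRep α (Fin m → ℂ) σ t) f = (tensorBasis α m).repr t (f ∘ σ) := by
  classical
  suffices h : Finsupp.lapply f ∘ₗ (tensorBasis α m).repr.toLinearMap ∘ₗ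
      tensorRep α (Fin m → ℂ) σ = Finsupp.lapply (f ∘ σ) ∘ₗ (tensorBasis α m).repr.toLinearMap from
    LinearMap.congr_fun h t
  refine (tensorBasis α m).ext fun g => ?_
  simp [tensorRep_tensorBasis, Finsupp.single_apply, Equiv.comp_symm_eq]

variable [Fintype α] [DecidableEq α] {ι κ : Type*} [DecidableEq ι] [DecidableEq κ]

/-- The dimension of the image of the Young symmetrizer on `(ℂ^m)^{⊗ α}`. -/
noncomputable def tensorRank (m : ℕ) (r : α → ι) (c : α → κ) : ℕ :=
  Module.finrank ℂ (LinearMap.range ((tensorRep α (Fin m → ℂ)).asAlgebraHom (youngElt r c)))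

lemma trace_tensorRep (m : ℕ) (x : MonoidAlgebra ℂ (Perm α)) :
    LinearMap.trace ℂ _ ((tensorRep α (Fin m → ℂ)).asAlgebraHom x) = fixTrace m x := by
  induction x using MonoidAlgebra.induction_linear with
  | zero => simp
  | add x y hx hy => simp [hx, hy]
  | single σ z =>
    rw [Representation.asAlgebraHom_single, map_smul, fixTrace_single, smul_eq_mul,
      trace_eq_card_fixed (tensorBasis α m) _ _ (tensorRep_tensorBasis σ), fixCount]
    congr 3
    ext f
    simp only [Finset.mem_filter, Finset.mem_univ, true_and, Equiv.comp_symm_eq]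
    exact eq_comm

lemma IsHookConstant.mul_tensorRank {r c : α → ℕ} (hd : IsDiagram r c) {h : ℂ}
    (hh : IsHookConstant r c h) (m : ℕ) :
    h * (tensorRank m r c : ℂ) = ∏ x, ((m : ℂ) + c x - r x) := by
  have hfd : FiniteDimensional ℂ (⨂[ℂ] _ : α, Fin m → ℂ) :=
    (tensorBasis α m).finiteDimensional_of_finite
  rw [← fixTrace_youngElt m hd, ← trace_tensorRep, tensorRank,
    mul_finrank_range_eq_trace _ (hh.ne_zero hd.inj)]
  rw [← map_mul, hh, map_smul]

end TensorPower

section Minors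

open Matrix
open scoped Kronecker

/-- Reindexing rows and columns separately changes the determinant by a sign, which does not
depend on the matrix. -/
lemma Matrix.det_submatrix_equiv_equiv {ι γ : Type*} [Fintype ι] [DecidableEq ι] [Fintype γ]
    [DecidableEq γ] (e e' : γ ≃ ι) :
    ∃ ε : ℂ, ∀ Y : Matrix ι ι ℂ, (Y.submatrix e e').det = ε * Y.det := by
  refine ⟨((Perm.sign (e.symm.trans e') : ℤ) : ℂ), fun Y => ?_⟩
  rw [← Matrix.det_permute', ← Matrix.det_submatrix_equiv_self e]
  congr 1
  ext i j
  simp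

/-- Jacobi's complementary minor theorem: a minor of `Y` is, up to sign, the determinant of `Y` times
the complementary minor of the inverse `Z`. -/
lemma Matrix.det_submatrix_inl_eq {ι A B : Type*} [Fintype ι] [DecidableEq ι] [Fintype A]
    [DecidableEq A] [Fintype B] [DecidableEq B] (e e' : A ⊕ B ≃ ι) {Y Z : Matrix ι ι ℂ}
    (h : Y * Z = 1) :
    (Y.submatrix (e ∘ Sum.inl) (e' ∘ Sum.inl)).det =
      (Y.submatrix e e').det * (Z.submatrix (e' ∘ Sum.inr) (e ∘ Sum.inr)).det := by
  have h1 : Y.submatrix e e' * Z.submatrix e' e = 1 := by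
    rw [Matrix.submatrix_mul_equiv, h, Matrix.submatrix_one_equiv]
  rw [← Matrix.fromBlocks_toBlocks (Y.submatrix e e'),
    ← Matrix.fromBlocks_toBlocks (Z.submatrix e' e), Matrix.fromBlocks_multiply,
    ← Matrix.fromBlocks_one, Matrix.fromBlocks_inj] at h1
  -- Replacing the first block column of `Z` by that of the identity turns `Y * Z = 1` into this.
  have h2 : Y.submatrix e e' * Matrix.fromBlocks 1 (Z.submatrix e' e).toBlocks₁₂ 0
      (Z.submatrix e' e).toBlocks₂₂ =
      Matrix.fromBlocks (Y.submatrix e e').toBlocks₁₁ 0 (Y.submatrix e e').toBlocks₂₁ 1 := by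
    conv_lhs => rw [← Matrix.fromBlocks_toBlocks (Y.submatrix e e'), Matrix.fromBlocks_multiply]
    rw [h1.2.1, h1.2.2.2]
    simp
  have h3 := congrArg Matrix.det h2
  rw [Matrix.det_mul, Matrix.det_fromBlocks_zero₂₁, Matrix.det_fromBlocks_zero₁₂, Matrix.det_one,
    Matrix.det_one, one_mul, mul_one] at h3
  exact h3.symm

variable {α : Type*} [Fintype α] [DecidableEq α] {m n : ℕ}

/-- The minor of `X ⊗ 1` with rows the boxes of `α` and columns obtained by replacing the row of
each box `x` by `f x`; it is the product over the columns of `α` of minors of `X`. -/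
noncomputable def columnMinor (r : α → Fin m) (c : α → Fin n) (f : α → Fin m)
    (X : Matrix (Fin m) (Fin m) ℂ) : ℂ :=
  ((X ⊗ₖ (1 : Matrix (Fin n) (Fin n) ℂ)).submatrix (fun x => (r x, c x))
    (fun x => (f x, c x))).det

lemma columnMinor_eq_sum (r : α → Fin m) (c : α → Fin n) (f : α → Fin m)
    (X : Matrix (Fin m) (Fin m) ℂ) :
    columnMinor r c f X = ∑ τ : Perm α with ∀ x, c (τ x) = c x,
      ((Perm.sign τ : ℤ) : ℂ) * ∏ x, X (r x) (f (τ.symm x)) := by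
  rw [columnMinor, Matrix.det_apply', Finset.sum_filter]
  refine Finset.sum_congr rfl fun τ _ => ?_
  simp only [Matrix.submatrix_apply, Matrix.kronecker_apply, Matrix.one_apply,
    Finset.prod_mul_distrib, Finset.prod_ite_zero, Finset.prod_const_one, Finset.mem_univ,
    true_implies]
  split_ifs with h1
  · rw [mul_one, ← Equiv.prod_comp τ fun x => X (r x) (f (τ.symm x))]
    simp
  · simp

variable {β : Type*} [Fintype β] [DecidableEq β]

/-- If the boxes of `α` and `β` partition the rectangle, each product of minors attached to `α` is,
up to a constant, a power of the determinant times one attached to `β`, evaluated at the inverse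
transpose. -/
lemma columnMinor_complement {r : α → Fin m} {c : α → Fin n} {r' : β → Fin m} {c' : β → Fin n}
    (E : α ⊕ β ≃ Fin m × Fin n) (hE : ∀ x, E (Sum.inl x) = (r x, c x))
    (hE' : ∀ y, E (Sum.inr y) = (r' y, c' y)) (f : α → Fin m) :
    ∃ (ε : ℂ) (g : β → Fin m), ∀ X Z : Matrix (Fin m) (Fin m) ℂ, X * Z = 1 →
      columnMinor r c f X = ε * (X.det ^ n * columnMinor r' c' g Zᵀ) := by
  by_cases hinj : ∀ x x', f x = f x' → c x = c x' → x = x'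
  · let φ : Fin n → Fin m → Fin m := fun j i => (E.symm (i, j)).elim f fun _ => i
    have hφ : ∀ x, φ (c x) (r x) = f x := fun x => by
      simp only [φ]
      rw [← hE, E.symm_apply_apply]; rfl
    have hσ : ∀ j, ∃ σ : Perm (Fin m), ∀ x, c x = j → σ (r x) = f x := by
      intro j
      obtain ⟨g, hg⟩ := Finset.exists_equiv_extend_of_card_eq (α := Fin m)
        (t := (Finset.univ : Finset (Fin m))) (by simp)
        (s := (Finset.univ.filter fun x => c x = j).image r) (f := φ j) (Finset.subset_univ _)
        (by
          intro i hi i' hi' h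
          simp only [Finset.coe_image, Set.mem_image, Finset.coe_filter, Finset.mem_univ, true_and,
            Set.mem_ofPred_eq] at hi hi'
          obtain ⟨x, hx, rfl⟩ := hi
          obtain ⟨x', hx', rfl⟩ := hi'
          subst hx
          rw [hφ, ← hx', hφ] at h
          rw [hinj x x' h hx'.symm])
      refine ⟨g.trans (Equiv.subtypeUnivEquiv fun x => Finset.mem_univ x), fun x hx => ?_⟩
      subst hx
      rw [← hφ x, ← hg _ (Finset.mem_image_of_mem _ (by simp))]
      rfl
    -- In column `j`, the partial map `r x ↦ f x` extends to a permutation `σ j` of all rows; the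
    -- complementary boxes then get the labels `g y = σ (c' y) (r' y)`.
    choose σ hσ using hσ
    let E' : α ⊕ β ≃ Fin m × Fin n := E.trans (Equiv.prodCongrLeft σ)
    obtain ⟨ε, hε⟩ := Matrix.det_submatrix_equiv_equiv E E'
    refine ⟨ε, fun y => σ (c' y) (r' y), fun X Z hXZ => ?_⟩
    have hYZ : X ⊗ₖ (1 : Matrix (Fin n) (Fin n) ℂ) *
        Z ⊗ₖ (1 : Matrix (Fin n) (Fin n) ℂ) = 1 := by
      rw [← Matrix.mul_kronecker_mul, hXZ, one_mul, Matrix.one_kronecker_one]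
    have h := Matrix.det_submatrix_inl_eq E E' hYZ
    rw [hε, Matrix.det_kronecker, Matrix.det_one, one_pow, mul_one, Fintype.card_fin,
      mul_assoc] at h
    convert h using 2
    · rw [columnMinor]
      congr 2
      · funext x; simp [hE]
      · funext x; simp [E', hE, hσ _ x rfl]
    · congr 1
      rw [columnMinor, ← Matrix.det_transpose]
      congr 1
      ext y y'
      simp [E', hE', Matrix.one_apply, eq_comm]
  · push Not at hinj
    obtain ⟨x, x', hf, hc, hne⟩ := hinj
    -- Two columns of the minor coincide, so that it vanishes.
    refine ⟨0, r', fun X Z _ => ?_⟩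
    rw [zero_mul, columnMinor]
    exact Matrix.det_zero_of_column_eq hne fun y => by simp [hf, hc]

end Minors

/-! ### The polynomial model of the image of a Young symmetrizer -/

section PolynomialModel

variable {α : Type*} [Fintype α] [DecidableEq α] {m : ℕ}

/-- The exponent vector of the monomial `∏ x, X (r x) (f x)` in the entries of an `m × m` matrix. -/
noncomputable def boxMonomial {α : Type*} [Fintype α] (r f : α → Fin m) : Fin m × Fin m →₀ ℕ :=
  ∑ x, Finsupp.single (r x, f x) 1

lemma boxMonomial_apply {α : Type*} [Fintype α] (r f : α → Fin m) (q : Fin m × Fin m) :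
    boxMonomial r f q = (Finset.univ.filter fun x => (r x, f x) = q).card := by
  simp [boxMonomial, Finsupp.finsetSum_apply, Finsupp.single_apply]

lemma exists_perm_of_boxMonomial_eq {α : Type*} [Fintype α] {r f g : α → Fin m} (h : boxMonomial r f = boxMonomial r g) :
    ∃ σ : Perm α, (∀ x, r (σ x) = r x) ∧ g ∘ σ = f := by
  classical
  have hcard : ∀ q, Nonempty ({x // (r x, f x) = q} ≃ {x // (r x, g x) = q}) := fun q => by
    rw [← Fintype.card_eq, Fintype.card_subtype, Fintype.card_subtype, ← boxMonomial_apply,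
      ← boxMonomial_apply, h]
  let e := fun q => (hcard q).some
  have he : ∀ x, (r (Equiv.ofFiberEquiv e x), g (Equiv.ofFiberEquiv e x)) = (r x, f x) :=
    fun x => Equiv.ofFiberEquiv_map (f := fun x => (r x, f x)) (g := fun x => (r x, g x)) e x
  exact ⟨Equiv.ofFiberEquiv e, fun x => congrArg Prod.fst (he x),
    funext fun x => congrArg Prod.snd (he x)⟩

/-- The tensor `e_f` as the polynomial function `X ↦ ∏ x, X (r x) (f x)` on invertible matrices.
It identifies the image of the row symmetrizer with a space of functions on `GL_m`. -/
noncomputable def toFunctions {α : Type*} [Fintype α] (r : α → Fin m) :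
    (⨂[ℂ] _ : α, Fin m → ℂ) →ₗ[ℂ] (Matrix (Fin m) (Fin m) ℂ)ˣ → ℂ :=
  (tensorBasis α m).constr ℂ fun f X => ∏ x, X.1 (r x) (f x)

lemma toFunctions_tensorBasis {α : Type*} [Fintype α] (r f : α → Fin m) (X : (Matrix (Fin m) (Fin m) ℂ)ˣ) :
    toFunctions r (tensorBasis α m f) X = ∏ x, X.1 (r x) (f x) := by
  rw [toFunctions, Module.Basis.constr_basis]

lemma toFunctions_comp_tensorRep {α : Type*} [Fintype α] {r : α → Fin m} {σ : Perm α} (hσ : ∀ x, r (σ x) = r x) :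
    toFunctions r ∘ₗ tensorRep α (Fin m → ℂ) σ = toFunctions r := by
  refine (tensorBasis α m).ext fun f => funext fun X => ?_
  rw [LinearMap.comp_apply, tensorRep_tensorBasis, toFunctions_tensorBasis,
    toFunctions_tensorBasis, ← Equiv.prod_comp σ]
  simp [hσ]

lemma toFunctions_rowSum (r : α → Fin m) (t : ⨂[ℂ] _ : α, Fin m → ℂ) :
    toFunctions r ((tensorRep α (Fin m → ℂ)).asAlgebraHom (rowSum r) t) =
      (Finset.univ.filter fun σ : Perm α => ∀ x, r (σ x) = r x).card • toFunctions r t := by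
  have h : ∀ σ ∈ Finset.univ.filter fun σ : Perm α => ∀ x, r (σ x) = r x,
      toFunctions r (tensorRep α (Fin m → ℂ) σ t) = toFunctions r t := fun σ hσ =>
    LinearMap.congr_fun (toFunctions_comp_tensorRep (Finset.mem_filter.mp hσ).2) t
  rw [rowSum, map_sum, LinearMap.sum_apply, map_sum]
  simp only [Representation.asAlgebraHom_single, one_smul]
  rw [Finset.sum_congr rfl h, Finset.sum_const]

lemma single_mul_rowSum {r : α → Fin m} {u : Perm α} (hu : ∀ x, r (u x) = r x) :
    single u 1 * rowSum r = rowSum r := by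
  simp only [rowSum, Finset.mul_sum, single_mul_single, mul_one]
  refine Finset.sum_equiv (Equiv.mulLeft u) (fun σ => ?_) (fun _ _ => rfl)
  simp [hu]

/-- A polynomial in the entries of a matrix that vanishes on `GL_m` is zero. -/
lemma eq_zero_of_eval_units_eq_zero (P : MvPolynomial (Fin m × Fin m) ℂ)
    (h : ∀ X : (Matrix (Fin m) (Fin m) ℂ)ˣ, MvPolynomial.eval (fun q => X.1 q.1 q.2) P = 0) :
    P = 0 := by
  have h1 : P * (Matrix.mvPolynomialX (Fin m) (Fin m) ℂ).det = 0 := by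
    refine MvPolynomial.funext fun x => ?_
    have hdet : MvPolynomial.eval x (Matrix.mvPolynomialX (Fin m) (Fin m) ℂ).det =
        (Matrix.of fun i j => x (i, j)).det := by
      rw [RingHom.map_det]
      congr 1
      ext i j
      simp [Matrix.mvPolynomialX]
    rw [map_mul, map_zero, hdet]
    by_cases h0 : (Matrix.of fun i j => x (i, j)).det = 0
    · rw [h0, mul_zero]
    · obtain ⟨X, hX⟩ := (Matrix.isUnit_iff_isUnit_det _).mpr (isUnit_iff_ne_zero.mpr h0)
      have := h X
      rw [hX] at this
      simp only [Matrix.of_apply] at this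
      rw [this, zero_mul]
  exact (mul_eq_zero.mp h1).resolve_right (Matrix.det_mvPolynomialX_ne_zero _ _)

/-- A row-invariant tensor is determined by its polynomial function, as the coefficient of the
monomial of `f` is a positive multiple of the coordinate at `f`. -/
lemma eq_zero_of_toFunctions_eq_zero {r : α → Fin m} (t : ⨂[ℂ] _ : α, Fin m → ℂ)
    (hinv : ∀ σ : Perm α, (∀ x, r (σ x) = r x) → tensorRep α (Fin m → ℂ) σ t = t)
    (h : toFunctions r t = 0) : t = 0 := by
  let P : MvPolynomial (Fin m × Fin m) ℂ :=
    ∑ f, MvPolynomial.monomial (boxMonomial r f) ((tensorBasis α m).repr t f)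
  have hP : P = 0 := by
    refine eq_zero_of_eval_units_eq_zero P fun X => ?_
    refine Eq.trans ?_ (congrFun h X)
    conv_rhs => rw [← (tensorBasis α m).sum_repr t]
    simp only [P, map_sum, map_smul, Finset.sum_apply, Pi.smul_apply, toFunctions_tensorBasis,
      MvPolynomial.eval_monomial, smul_eq_mul]
    refine Finset.sum_congr rfl fun f _ => ?_
    congr 1
    rw [boxMonomial, ← Finsupp.prod_finsetSum_index (by simp) (by simp [pow_add])]
    simp
  refine (tensorBasis α m).repr.map_eq_zero_iff.mp (Finsupp.ext fun f => ?_)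
  have hcoeff : MvPolynomial.coeff (boxMonomial r f) P = 0 := by rw [hP]; simp
  simp only [P, MvPolynomial.coeff_sum, MvPolynomial.coeff_monomial] at hcoeff
  rw [← Finset.sum_filter, Finset.sum_congr rfl (g := fun _ => (tensorBasis α m).repr t f),
    Finset.sum_const, smul_eq_zero] at hcoeff
  · refine hcoeff.resolve_left (Finset.card_ne_zero_of_mem (a := f) (by simp))
  · intro g hg
    obtain ⟨σ, hσ, rfl⟩ := exists_perm_of_boxMonomial_eq (by simpa using hg)
    rw [← repr_tensorRep, hinv σ hσ]

lemma ker_rowSum (r : α → Fin m) :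
    LinearMap.ker ((tensorRep α (Fin m → ℂ)).asAlgebraHom (rowSum r)) =
      LinearMap.ker (toFunctions r) := by
  have hcard : (Finset.univ.filter fun σ : Perm α => ∀ x, r (σ x) = r x).card ≠ 0 :=
    Finset.card_ne_zero_of_mem (a := 1) (by simp)
  ext t
  have h1 := toFunctions_rowSum r t
  rw [LinearMap.mem_ker, LinearMap.mem_ker]
  constructor
  · intro h
    rw [h, map_zero] at h1
    exact (smul_eq_zero.mp h1.symm).resolve_left hcard
  · intro h
    rw [h, smul_zero] at h1
    refine eq_zero_of_toFunctions_eq_zero _ (fun σ hσ => ?_) h1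
    rw [← Representation.asAlgebraHom_single_one, ← Module.End.mul_apply, ← map_mul,
      single_mul_rowSum hσ]

variable {n : ℕ}

lemma toFunctions_colSum (r : α → Fin m) (c : α → Fin n) (f : α → Fin m)
    (X : (Matrix (Fin m) (Fin m) ℂ)ˣ) :
    toFunctions r ((tensorRep α (Fin m → ℂ)).asAlgebraHom (colSum c) (tensorBasis α m f)) X =
      columnMinor r c f X.1 := by
  rw [columnMinor_eq_sum, colSum]
  simp only [map_sum, LinearMap.sum_apply, Representation.asAlgebraHom_single,
    LinearMap.smul_apply, tensorRep_tensorBasis, map_smul, Finset.sum_apply, Pi.smul_apply,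
    toFunctions_tensorBasis, smul_eq_mul, Function.comp_apply]

/-- The span of the functions `columnMinor r c f` on `GL_m`. -/
noncomputable def minorSpan (r : α → Fin m) (c : α → Fin n) :
    Submodule ℂ ((Matrix (Fin m) (Fin m) ℂ)ˣ → ℂ) :=
  Submodule.span ℂ (Set.range fun f X => columnMinor r c f X.1)

/-- The polynomial model: since the row symmetrizer has the same kernel as `toFunctions`, the image
of the Young symmetrizer has the dimension of the span of the products of minors. -/
lemma tensorRank_eq_finrank_minorSpan (r : α → Fin m) (c : α → Fin n) :
    tensorRank m r c = Module.finrank ℂ (minorSpan r c) := by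
  have hfd : FiniteDimensional ℂ (⨂[ℂ] _ : α, Fin m → ℂ) :=
    (tensorBasis α m).finiteDimensional_of_finite
  have hspan : minorSpan r c = LinearMap.range
      (toFunctions r ∘ₗ (tensorRep α (Fin m → ℂ)).asAlgebraHom (colSum c)) := by
    rw [LinearMap.range_eq_map, ← (tensorBasis α m).span_eq, Submodule.map_span, ← Set.range_comp,
      minorSpan]
    congr 2
    funext f X
    exact (toFunctions_colSum r c f X).symm
  have hker : LinearMap.ker ((tensorRep α (Fin m → ℂ)).asAlgebraHom (youngElt r c)) =
      LinearMap.ker (toFunctions r ∘ₗ (tensorRep α (Fin m → ℂ)).asAlgebraHom (colSum c)) := by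
    rw [youngElt, map_mul, Module.End.mul_eq_comp, LinearMap.ker_comp, ker_rowSum,
      ← LinearMap.ker_comp]
  have h1 := LinearMap.finrank_range_add_finrank_ker
    ((tensorRep α (Fin m → ℂ)).asAlgebraHom (youngElt r c))
  have h2 := LinearMap.finrank_range_add_finrank_ker
    (toFunctions r ∘ₗ (tensorRep α (Fin m → ℂ)).asAlgebraHom (colSum c))
  rw [tensorRank, hspan]
  rw [hker] at h1
  omega

variable {β : Type*} [Fintype β] [DecidableEq β]

/-- By Jacobi's theorem, the substitution `X ↦ X⁻ᵀ` followed by multiplication with `det X ^ n` maps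
the span attached to the complement onto a space containing the span attached to `α`. -/
lemma tensorRank_le_of_complement {r : α → Fin m} {c : α → Fin n} {r' : β → Fin m}
    {c' : β → Fin n} (E : α ⊕ β ≃ Fin m × Fin n) (hE : ∀ x, E (Sum.inl x) = (r x, c x))
    (hE' : ∀ y, E (Sum.inr y) = (r' y, c' y)) : tensorRank m r c ≤ tensorRank m r' c' := by
  rw [tensorRank_eq_finrank_minorSpan, tensorRank_eq_finrank_minorSpan]
  let transposeInv : (Matrix (Fin m) (Fin m) ℂ)ˣ → (Matrix (Fin m) (Fin m) ℂ)ˣ := fun X =>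
    ⟨X⁻¹.1.transpose, X.1.transpose, by rw [← Matrix.transpose_mul]; simp,
      by rw [← Matrix.transpose_mul]; simp⟩
  let Ψ : ((Matrix (Fin m) (Fin m) ℂ)ˣ → ℂ) →ₗ[ℂ] ((Matrix (Fin m) (Fin m) ℂ)ˣ → ℂ) :=
    { toFun := fun F X => X.1.det ^ n * F (transposeInv X)
      map_add' := fun F G => funext fun X => mul_add _ _ _
      map_smul' := fun a F => funext fun X => mul_left_comm _ _ _ }
  have hfin : FiniteDimensional ℂ (minorSpan r' c') :=
    FiniteDimensional.span_of_finite ℂ (Set.finite_range _)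
  have hle : minorSpan r c ≤ (minorSpan r' c').map Ψ := by
    refine Submodule.span_le.mpr ?_
    rintro _ ⟨f, rfl⟩
    obtain ⟨ε, g, h⟩ := columnMinor_complement E hE hE' f
    refine ⟨ε • fun X => columnMinor r' c' g X.1, Submodule.smul_mem _ _
      (Submodule.subset_span ⟨g, rfl⟩), funext fun X => ?_⟩
    rw [map_smul]
    exact (h X.1 X⁻¹.1 X.mul_inv).symm
  exact (Submodule.finrank_mono hle).trans (Submodule.finrank_map_le _ _)

/-- Complementary sets of boxes in the `m × n` rectangle give images of the same dimension. -/
theorem tensorRank_eq_of_complement {r : α → Fin m} {c : α → Fin n} {r' : β → Fin m}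
    {c' : β → Fin n} (E : α ⊕ β ≃ Fin m × Fin n) (hE : ∀ x, E (Sum.inl x) = (r x, c x))
    (hE' : ∀ y, E (Sum.inr y) = (r' y, c' y)) : tensorRank m r c = tensorRank m r' c' :=
  le_antisymm (tensorRank_le_of_complement E hE hE')
    (tensorRank_le_of_complement ((Equiv.sumComm β α).trans E) hE' hE)

end PolynomialModel

/-! ### Complementary diagrams in a rectangle -/

section Diagrams

lemma youngElt_congr {α ι κ ι' κ' : Type*} [Fintype α] [DecidableEq α] [DecidableEq ι]
    [DecidableEq κ] [DecidableEq ι'] [DecidableEq κ'] {r : α → ι} {c : α → κ} {r' : α → ι'}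
    {c' : α → κ'} (hr : ∀ x y, r x = r y ↔ r' x = r' y) (hc : ∀ x y, c x = c y ↔ c' x = c' y) :
    youngElt r c = youngElt r' c' := by
  simp only [youngElt, rowSum, colSum, hr, hc]

/-- The row of a box of `D`. -/
def boxRow (D : Finset (ℕ × ℕ)) (x : D) : ℕ := x.1.1

/-- The column of a box of `D`. -/
def boxCol (D : Finset (ℕ × ℕ)) (x : D) : ℕ := x.1.2

lemma box_injective (D : Finset (ℕ × ℕ)) (x y : D) (h1 : boxRow D x = boxRow D y)
    (h2 : boxCol D x = boxCol D y) : x = y :=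
  Subtype.ext (Prod.ext h1 h2)

lemma prod_boxes (D : Finset (ℕ × ℕ)) (m : ℕ) :
    ∏ x : D, ((m : ℂ) + boxCol D x - boxRow D x) = ∏ x ∈ D, ((m : ℂ) + x.2 - x.1) :=
  Finset.prod_coe_sort D fun x => ((m : ℂ) + x.2 - x.1)

lemma spechtDim_eq_spechtRank (D : Finset (ℕ × ℕ)) :
    spechtDim D = spechtRank (boxRow D) (boxCol D) := by
  have h : (spechtModule D).restrictScalars ℂ =
      LinearMap.range (LinearMap.mulRight ℂ (youngElt (boxRow D) (boxCol D))) := by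
    ext x
    rw [Submodule.restrictScalars_mem, spechtModule, Ideal.mem_span_singleton']
    rfl
  rw [spechtRank, ← h]
  rfl

lemma finrank_schurModule (mu : YoungDiagram) (m : ℕ) :
    Module.finrank ℂ (schurModule mu (Fin m → ℂ)) =
      tensorRank m (boxRow mu.cells) (boxCol mu.cells) := rfl

lemma isDiagram_cells (mu : YoungDiagram) : IsDiagram (boxRow mu.cells) (boxCol mu.cells) :=
  ⟨box_injective _, fun x i j hi hj =>
    ⟨⟨(i, j), mu.isLowerSet (show ((i, j) : ℕ × ℕ) ≤ x.1 from ⟨hi, hj⟩) x.2⟩, rfl, rfl⟩⟩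

lemma exists_isHookConstant_cells (mu : YoungDiagram) :
    ∃ h, IsHookConstant (boxRow mu.cells) (boxCol mu.cells) h :=
  exists_youngElt_mul_self (isDiagram_cells mu)

lemma mem_rectDiagram_cells {m n : ℕ} {x : ℕ × ℕ} :
    x ∈ (rectDiagram m n).cells ↔ x.1 < m ∧ x.2 < n := by
  simp [rectDiagram]

section Complement

variable {m n : ℕ} {lam : YoungDiagram}

/-- Rotated by a half turn, the complement of a diagram in the rectangle is a Young diagram. -/
lemma isDiagram_complement (lam : YoungDiagram) :
    IsDiagram (fun x => m - 1 - boxRow ((rectDiagram m n).cells \ lam.cells) x)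
      (fun x => n - 1 - boxCol ((rectDiagram m n).cells \ lam.cells) x) := by
  have hlt : ∀ x : ↥((rectDiagram m n).cells \ lam.cells), x.1.1 < m ∧ x.1.2 < n := fun x =>
    mem_rectDiagram_cells.mp (Finset.mem_sdiff.mp x.2).1
  constructor
  · intro x y h1 h2
    have hx := hlt x
    have hy := hlt y
    refine box_injective _ x y ?_ ?_ <;> simp only [boxRow, boxCol] at * <;> omega
  · intro x i j hi hj
    have hx := hlt x
    simp only [boxRow, boxCol] at hi hj ⊢
    refine ⟨⟨(m - 1 - i, n - 1 - j), Finset.mem_sdiff.mpr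
      ⟨mem_rectDiagram_cells.mpr ⟨by dsimp only; omega, by dsimp only; omega⟩, fun h => ?_⟩⟩,
      by dsimp only; omega, by dsimp only; omega⟩
    refine (Finset.mem_sdiff.mp x.2).2 (lam.isLowerSet ?_ h)
    constructor <;> dsimp only <;> omega

lemma youngElt_complement (lam : YoungDiagram) :
    youngElt (fun x => m - 1 - boxRow ((rectDiagram m n).cells \ lam.cells) x)
      (fun x => n - 1 - boxCol ((rectDiagram m n).cells \ lam.cells) x) =
    youngElt (boxRow ((rectDiagram m n).cells \ lam.cells))
      (boxCol ((rectDiagram m n).cells \ lam.cells)) := by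
  have hlt : ∀ x : ↥((rectDiagram m n).cells \ lam.cells), x.1.1 < m ∧ x.1.2 < n := fun x =>
    mem_rectDiagram_cells.mp (Finset.mem_sdiff.mp x.2).1
  refine youngElt_congr (fun x y => ?_) (fun x y => ?_) <;>
  · have hx := hlt x
    have hy := hlt y
    simp only [boxRow, boxCol]
    omega

lemma exists_isHookConstant_complement (lam : YoungDiagram) :
    ∃ h, IsHookConstant (boxRow ((rectDiagram m n).cells \ lam.cells))
      (boxCol ((rectDiagram m n).cells \ lam.cells)) h := by
  have h := exists_youngElt_mul_self (isDiagram_complement (m := m) (n := n) lam)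
  rwa [youngElt_complement] at h

lemma tensorRank_complement (hlam : lam ≤ rectDiagram m n) :
    tensorRank m (boxRow lam.cells) (boxCol lam.cells) =
      tensorRank m (boxRow ((rectDiagram m n).cells \ lam.cells))
        (boxCol ((rectDiagram m n).cells \ lam.cells)) := by
  have hL : ∀ x : lam.cells, x.1.1 < m ∧ x.1.2 < n := fun x =>
    mem_rectDiagram_cells.mp (hlam x.2)
  have hB : ∀ x : ↥((rectDiagram m n).cells \ lam.cells), x.1.1 < m ∧ x.1.2 < n := fun x =>
    mem_rectDiagram_cells.mp (Finset.mem_sdiff.mp x.2).1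
  let F : lam.cells ⊕ ↥((rectDiagram m n).cells \ lam.cells) → Fin m × Fin n :=
    Sum.elim (fun x => (⟨x.1.1, (hL x).1⟩, ⟨x.1.2, (hL x).2⟩))
      (fun x => (⟨x.1.1, (hB x).1⟩, ⟨x.1.2, (hB x).2⟩))
  have hF : Function.Bijective F := by
    constructor
    · rintro (x | x) (y | y) h <;>
        simp only [F, Sum.elim_inl, Sum.elim_inr, Prod.mk.injEq, Fin.mk.injEq] at h
      · rw [Subtype.ext (Prod.ext h.1 h.2)]
      · exact absurd (Prod.ext h.1 h.2 ▸ x.2) (Finset.mem_sdiff.mp y.2).2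
      · exact absurd ((Prod.ext h.1 h.2 : x.1 = y.1) ▸ y.2) (Finset.mem_sdiff.mp x.2).2
      · rw [Subtype.ext (Prod.ext h.1 h.2)]
    · rintro ⟨i, j⟩
      by_cases h : ((i : ℕ), (j : ℕ)) ∈ lam.cells
      · exact ⟨Sum.inl ⟨_, h⟩, rfl⟩
      · exact ⟨Sum.inr ⟨_, Finset.mem_sdiff.mpr ⟨mem_rectDiagram_cells.mpr ⟨i.2, j.2⟩, h⟩⟩, rfl⟩
  have key := tensorRank_eq_of_complement (Equiv.ofBijective F hF)
    (r := fun x => ⟨x.1.1, (hL x).1⟩) (c := fun x => ⟨x.1.2, (hL x).2⟩)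
    (r' := fun x => ⟨x.1.1, (hB x).1⟩) (c' := fun x => ⟨x.1.2, (hB x).2⟩)
    (fun _ => rfl) (fun _ => rfl)
  rw [tensorRank, tensorRank] at key ⊢
  rwa [youngElt_congr (r' := boxRow lam.cells) (c' := boxCol lam.cells)
      (by simp [boxRow]) (by simp [boxCol]),
    youngElt_congr (r' := boxRow ((rectDiagram m n).cells \ lam.cells))
      (c' := boxCol ((rectDiagram m n).cells \ lam.cells)) (by simp [boxRow])
      (by simp [boxCol])] at key

/-- The hook constants of complementary diagrams compare as the content products of their
tensor images, since these images have the same dimension. -/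
lemma hookConstant_complement (hlam : lam ≤ rectDiagram m n) {h h' : ℂ}
    (hh : IsHookConstant (boxRow lam.cells) (boxCol lam.cells) h)
    (hh' : IsHookConstant (boxRow ((rectDiagram m n).cells \ lam.cells))
      (boxCol ((rectDiagram m n).cells \ lam.cells)) h') :
    h' * ∏ x ∈ lam.cells, ((m : ℂ) + x.2 - x.1) =
      h * ∏ x ∈ (rectDiagram m n).cells \ lam.cells, ((n : ℂ) + x.1 - x.2) := by
  have h1 := hh.mul_tensorRank (isDiagram_cells lam) m
  have hc : IsHookConstant (fun x => m - 1 - boxRow ((rectDiagram m n).cells \ lam.cells) x)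
      (fun x => n - 1 - boxCol ((rectDiagram m n).cells \ lam.cells) x) h' := by
    rwa [IsHookConstant, youngElt_complement]
  have h2 := hc.mul_tensorRank (isDiagram_complement lam) m
  rw [tensorRank, youngElt_complement, ← tensorRank, ← tensorRank_complement hlam] at h2
  have h3 : ∏ x : ↥((rectDiagram m n).cells \ lam.cells),
      ((m : ℂ) + (n - 1 - boxCol _ x : ℕ) - (m - 1 - boxRow _ x : ℕ)) =
      ∏ x ∈ (rectDiagram m n).cells \ lam.cells, ((n : ℂ) + x.1 - x.2) := by
    rw [← Finset.prod_coe_sort _ fun x : ℕ × ℕ => ((n : ℂ) + x.1 - x.2)]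
    refine Finset.prod_congr rfl fun x _ => ?_
    have hx := mem_rectDiagram_cells.mp (Finset.mem_sdiff.mp x.2).1
    simp only [boxRow, boxCol]
    rw [Nat.sub_sub, Nat.sub_sub, Nat.cast_sub (by omega), Nat.cast_sub (by omega)]
    push_cast
    ring
  rw [h3] at h2
  rw [prod_boxes] at h1
  rw [← h1, ← h2]
  ring

/-- Applied to the empty diagram, the comparison of complementary diagrams computes the hook
constant of the rectangle. -/
lemma hookConstant_rectDiagram {h : ℂ}
    (hh : IsHookConstant (boxRow (rectDiagram m n).cells) (boxCol (rectDiagram m n).cells) h) :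
    h = ∏ x ∈ (rectDiagram m n).cells, ((n : ℂ) + x.1 - x.2) := by
  have h0 : IsHookConstant (boxRow (⊥ : YoungDiagram).cells) (boxCol (⊥ : YoungDiagram).cells)
      1 := by
    have : IsEmpty (⊥ : YoungDiagram).cells := ⟨fun x => YoungDiagram.notMem_bot x.1 x.2⟩
    have hr : youngElt (boxRow (⊥ : YoungDiagram).cells) (boxCol (⊥ : YoungDiagram).cells) = 1 := by
      simp [youngElt, rowSum, colSum, Finset.univ_unique, MonoidAlgebra.one_def,
        Subsingleton.elim _ (1 : Perm (⊥ : YoungDiagram).cells)]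
    rw [IsHookConstant, hr, one_mul, one_smul]
  have hcells : (rectDiagram m n).cells \ (⊥ : YoungDiagram).cells = (rectDiagram m n).cells := by
    simp
  have key := hookConstant_complement (m := m) (n := n) (h' := h) bot_le h0
    (by rw [hcells]; exact hh)
  rw [hcells] at key
  simpa using key

end Complement

lemma IsHookConstant.transpose_cells {lam : YoungDiagram} {h : ℂ}
    (hh : IsHookConstant (boxRow lam.cells) (boxCol lam.cells) h) :
    IsHookConstant (boxRow lam.transpose.cells) (boxCol lam.transpose.cells) h := by
  let e : lam.transpose.cells ≃ lam.cells :=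
    (Equiv.prodComm ℕ ℕ).subtypeEquiv fun x => by
      rw [YoungDiagram.mem_cells, YoungDiagram.mem_transpose]; rfl
  exact hh.transpose.comp_equiv e

lemma prod_transpose_cells (lam : YoungDiagram) (n : ℕ) :
    ∏ x : lam.transpose.cells, ((n : ℂ) + boxCol _ x - boxRow _ x) =
      ∏ x ∈ lam.cells, ((n : ℂ) + x.1 - x.2) := by
  rw [prod_boxes]
  refine Finset.prod_equiv (Equiv.prodComm ℕ ℕ) (fun x => ?_) (fun x _ => rfl)
  rw [YoungDiagram.mem_cells, YoungDiagram.mem_transpose]; rfl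

end Diagrams

theorem theorem1p1 (m n p : ℕ) (hm : 1 ≤ m) (hn : 1 ≤ n) (lam : YoungDiagram)
    (hlam : lam ≤ rectDiagram m n) (hp : lam.card = p) :
    ((Module.finrank ℂ (schurModule lam (Fin m → ℂ)) : ℚ) *
        (Module.finrank ℂ (schurModule lam.transpose (Fin n → ℂ)) : ℚ)) /
        (Module.finrank ℂ (⋀[ℂ]^p ((Fin m → ℂ) ⊗[ℂ] (Fin n → ℂ))) : ℚ) =
      ((spechtDim lam.cells : ℚ) * (spechtDim ((rectDiagram m n).cells \ lam.cells) : ℚ)) /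
        (spechtDim (rectDiagram m n).cells : ℚ) := by
  obtain ⟨h, hh⟩ := exists_isHookConstant_cells lam
  obtain ⟨h', hh'⟩ := exists_isHookConstant_complement (m := m) (n := n) lam
  obtain ⟨hR, hhR⟩ := exists_isHookConstant_cells (rectDiagram m n)
  have hcardR : (rectDiagram m n).cells.card = m * n := by simp [rectDiagram]
  have hcardL : lam.cells.card = p := hp
  have hpmn : p ≤ m * n := by
    rw [← hcardL, ← hcardR]; exact Finset.card_le_card hlam
  have hcardB : ((rectDiagram m n).cells \ lam.cells).card = m * n - p := by
    rw [Finset.card_sdiff_of_subset hlam, hcardL, hcardR]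
  have hdim : Module.finrank ℂ (⋀[ℂ]^p ((Fin m → ℂ) ⊗[ℂ] (Fin n → ℂ))) = (m * n).choose p := by
    rw [exteriorPower.finrank_eq, Module.finrank_tensorProduct]; simp
  have h0 := hh.ne_zero (box_injective _)
  have h0' := hh'.ne_zero (box_injective _)
  have f1 := hh.mul_spechtRank (box_injective _)
  have f2 := hh'.mul_spechtRank (box_injective _)
  have f3 := hhR.mul_spechtRank (box_injective _)
  rw [← spechtDim_eq_spechtRank, Fintype.card_coe] at f1 f2 f3
  rw [hcardL] at f1
  rw [hcardB] at f2
  rw [hcardR] at f3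
  have d1 := hh.mul_tensorRank (isDiagram_cells lam) m
  have d2 := hh.transpose_cells.mul_tensorRank (isDiagram_cells _) n
  rw [prod_transpose_cells, ← finrank_schurModule] at d2
  rw [prod_boxes, ← finrank_schurModule] at d1
  have hprod := hookConstant_complement hlam hh hh'
  have hrect := hookConstant_rectDiagram hhR
  rw [← Finset.prod_sdiff hlam, ← d2] at hrect
  rw [← d1] at hprod
  have hchoose := Nat.choose_mul_factorial_mul_factorial hpmn
  rw [hdim]
  have hfR : (spechtDim (rectDiagram m n).cells : ℂ) ≠ 0 := by
    intro hz
    rw [hz, mul_zero] at f3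
    exact Nat.cast_ne_zero.mpr (Nat.factorial_ne_zero _) f3.symm
  have hch : ((m * n).choose p : ℂ) ≠ 0 := Nat.cast_ne_zero.mpr (Nat.choose_pos hpmn).ne'
  have hC : ((m * n).choose p : ℂ) * p.factorial * (m * n - p).factorial = (m * n).factorial := by
    exact_mod_cast hchoose
  suffices hgoal : ((Module.finrank ℂ (schurModule lam (Fin m → ℂ)) : ℂ) *
        (Module.finrank ℂ (schurModule lam.transpose (Fin n → ℂ)) : ℂ)) / ((m * n).choose p : ℂ) =
      ((spechtDim lam.cells : ℂ) * (spechtDim ((rectDiagram m n).cells \ lam.cells) : ℂ)) /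
        (spechtDim (rectDiagram m n).cells : ℂ) by
    apply Rat.cast_injective (α := ℂ)
    push_cast
    exact hgoal
  rw [div_eq_div_iff hch hfR]
  rw [← f1, ← f2, ← f3, hrect] at hC
  generalize ∏ x ∈ (rectDiagram m n).cells \ lam.cells, ((n : ℂ) + x.1 - x.2) = Q at *
  -- Duality: `h' dim S^λ(ℂ^m) = ∏_μ (n - c)`, so that `hR` is `h h'` times the two dimensions.
  have hQ : h' * (Module.finrank ℂ (schurModule lam (Fin m → ℂ)) : ℂ) = Q :=
    mul_left_cancel₀ h0 (by rw [← hprod]; ring)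
  rw [← hQ] at hC
  refine mul_left_cancel₀ (mul_ne_zero h0 h0') ?_
  linear_combination -hC
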